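/- Let $F_1 = F_2 = 1$ and $F_n = F_{n-1} + F_{n-2}$ be the Fibonacci numbers. The Fibonacci trees are the rooted trees defined recursively as follows: $T_1^F = T_2^F$ is the one-vertex tree, and for $N \ge 3$ the tree $T_N^F$ consists of a root $u_1$ whose only child is $u_2$, where the two subtrees hanging from $u_2$ (joined to it by their roots) are a copy of $T_{N-1}^F$ and a copy of $T_{N-2}^F$. For an integer $k$ and a real number $l$, a red-blue-yellow $(k, l)$-decomposition of a tree $T$ is a partition $V(T) = R \cup B \cup Y$ into pairwise disjoint, possibly empty sets such that $|Y| \le l$, the sets $R$ and $B$ are independent in $T$, and $|R| - |B| = k$. Theorem. For every integer $N \ge 96$, every integer $k \in \left[0, F_{\lceil N/2 - 1 \rceil} - \frac{N}{24} + 2\right]$ and every real number $l \in \left[1, \frac{N}{48} - 1\right]$, the tree $T_N^F$ has no red-blue-yellow $(k, l)$-decomposition. -/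

import Mathlib

/-- `(R, B, Y)` is a red-blue-yellow `(k, l)`-decomposition of the graph `G`: the (possibly empty)
sets `R`, `B`, `Y` partition the vertex set, `|Y| ≤ l`, the sets `R` and `B` are independent, and
`|R| - |B| = k`. The bound `l` may be any real number. -/
structure IsRedBlueYellowDecomposition {V : Type*} (G : SimpleGraph V) (k : ℤ) (l : ℝ)
    (R B Y : Finset V) : Prop where
  disjoint_red_blue : Disjoint R B
  disjoint_red_yellow : Disjoint R Y
  disjoint_blue_yellow : Disjoint B Y
  cover : ∀ v : V, v ∈ R ∨ v ∈ B ∨ v ∈ Y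
  card_yellow_le : (Y.card : ℝ) ≤ l
  indep_red : G.IsIndepSet (R : Set V)
  indep_blue : G.IsIndepSet (B : Set V)
  card_sub_card : (R.card : ℤ) - (B.card : ℤ) = k

/-- Vertices of the `N`-th Fibonacci tree. For `N = 1, 2` there is only the root; for `N ≥ 3` there
are the root, its only child, and the vertices of the two subtrees hanging from that child, which
are copies of the `(N - 1)`-th and the `(N - 2)`-th Fibonacci trees.
(The index `N = 0` is not used; it is given a single vertex.) -/
inductive FibTreeVertex : ℕ → Type
  | root (N : ℕ) : FibTreeVertex N
  | child (N : ℕ) : FibTreeVertex (N + 3)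
  | left {N : ℕ} (v : FibTreeVertex (N + 2)) : FibTreeVertex (N + 3)
  | right {N : ℕ} (v : FibTreeVertex (N + 1)) : FibTreeVertex (N + 3)

/-- `FibTreeParent u v`: the vertex `u` is the parent of the vertex `v` in the rooted `N`-th
Fibonacci tree. -/
inductive FibTreeParent : {N : ℕ} → FibTreeVertex N → FibTreeVertex N → Prop
  | root_child (N : ℕ) : FibTreeParent (FibTreeVertex.root (N + 3)) (FibTreeVertex.child N)
  | child_left (N : ℕ) :
      FibTreeParent (FibTreeVertex.child N) (FibTreeVertex.left (FibTreeVertex.root (N + 2)))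
  | child_right (N : ℕ) :
      FibTreeParent (FibTreeVertex.child N) (FibTreeVertex.right (FibTreeVertex.root (N + 1)))
  | left {N : ℕ} {u v : FibTreeVertex (N + 2)} (h : FibTreeParent u v) :
      FibTreeParent (FibTreeVertex.left u) (FibTreeVertex.left v)
  | right {N : ℕ} {u v : FibTreeVertex (N + 1)} (h : FibTreeParent u v) :
      FibTreeParent (FibTreeVertex.right u) (FibTreeVertex.right v)

/-- The `N`-th Fibonacci tree as a simple graph: two vertices are adjacent when one of them is the
parent of the other. -/
def fibTree (N : ℕ) : SimpleGraph (FibTreeVertex N) :=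
  SimpleGraph.fromRel fun u v => FibTreeParent u v

/-- The vertices of a Fibonacci tree of index at least three, as a disjoint sum. -/
def FibTreeVertex.equivSum (N : ℕ) :
    FibTreeVertex (N + 3) ≃ (Unit ⊕ Unit) ⊕ (FibTreeVertex (N + 2) ⊕ FibTreeVertex (N + 1)) where
  toFun
    | .root _ => .inl (.inl ())
    | .child _ => .inl (.inr ())
    | .left v => .inr (.inl v)
    | .right v => .inr (.inr v)
  invFun
    | .inl (.inl ()) => .root _
    | .inl (.inr ()) => .child _
    | .inr (.inl v) => .left v
    | .inr (.inr v) => .right v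
  left_inv v := by cases v <;> rfl
  right_inv v := by rcases v with (_ | _) | (_ | _) <;> rfl

/-- A Fibonacci tree has finitely many vertices. -/
instance FibTreeVertex.instFinite : (N : ℕ) → Finite (FibTreeVertex N)
  | 0 => @Finite.of_subsingleton _ ⟨fun a b => by cases a; cases b; rfl⟩
  | 1 => @Finite.of_subsingleton _ ⟨fun a b => by cases a; cases b; rfl⟩
  | 2 => @Finite.of_subsingleton _ ⟨fun a b => by cases a; cases b; rfl⟩
  | N + 3 => by
      have h1 := FibTreeVertex.instFinite (N + 2)
      have h2 := FibTreeVertex.instFinite (N + 1)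
      exact Finite.of_equiv _ (FibTreeVertex.equivSum N).symm

/-! Give red, blue and yellow vertices the values `1`, `-1`, `0`, so that the values sum to `k`.
Without yellow, each root cancels its child and the sum is `± F_N`; each yellow vertex flips the
signs of at most two subtrees and adds an error of at most one. So `k` is within `y` (the number of
yellow vertices) of `ε F_N + 2x`, with `x` a signed sum of at most `2y` Fibonacci numbers
(`exists_signedFibSum_of_coloring`). Such a number is large (`fib_le_abs_add_two_mul_signedFibSum`).
Make the indices distinct and drop those below a long gap: if the total were small, the rest would
give an element of `ℤ[φ]` with small value and tiny conjugate, hence norm below `1` in absolute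
value. But that norm is odd. -/

/-! ### Fibonacci sums with distinct indices -/

open Finset in
/-- A sum of Fibonacci numbers with repetitions can be rewritten, without using more summands, as a
sum of Fibonacci numbers with distinct indices. -/
theorem exists_finset_sum_fib_eq (s : Multiset ℕ) :
    ∃ T : Finset ℕ, T.card ≤ Multiset.card s ∧ ∑ i ∈ T, Nat.fib i = (s.map Nat.fib).sum := by
  have sq_le : ∀ s : Multiset ℕ, (s.map fun i => Nat.fib i ^ 2).sum ≤ (s.map Nat.fib).sum ^ 2 := by
    intro s
    induction s using Multiset.induction_on with
    | empty => simp
    | cons a s ih =>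
      simp only [Multiset.map_cons, Multiset.sum_cons]
      nlinarith [Nat.zero_le (Nat.fib a * (s.map Nat.fib).sum)]
  -- Each exchange keeps the sum and raises the sum of squares, which `sq_le` bounds, so the process
  -- terminates.
  induction hd : (s.map Nat.fib).sum ^ 2 - (s.map fun i => Nat.fib i ^ 2).sum
    using Nat.strong_induction_on generalizing s with
  | _ d ih =>
  subst hd
  by_cases hdup : ∃ n, 1 ≤ n ∧ ∃ u : Multiset ℕ, s = n ::ₘ n ::ₘ u
  · obtain ⟨n, hn, u, rfl⟩ := hdup
    -- `2 F_n = F_{n+1} + F_{n-2}`, where `F_{-1} = 1 = F_1`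
    obtain ⟨a, b, hab, ha⟩ : ∃ a b, Nat.fib a + Nat.fib b = 2 * Nat.fib n ∧
        Nat.fib n < Nat.fib a := by
      obtain rfl | ⟨c, rfl⟩ : n = 1 ∨ ∃ c, n = c + 2 := by
        rcases n with _ | _ | c
        · omega
        · simp
        · exact Or.inr ⟨c, rfl⟩
      -- `F_2 + F_{-1}` would leave the squares unchanged; as `F_1 = F_2`, the exchange for `n = 2`
      -- is used.
      · exact ⟨3, 0, by decide, by decide⟩
      · refine ⟨c + 3, c, ?_, Nat.fib_lt_fib_succ (by omega)⟩
        have h1 := Nat.fib_add_two (n := c)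
        have h2 := Nat.fib_add_two (n := c + 1)
        simp only [show c + 1 + 2 = c + 3 by omega, show c + 1 + 1 = c + 2 by omega] at h2
        omega
    have hsum : ((a ::ₘ b ::ₘ u).map Nat.fib).sum = ((n ::ₘ n ::ₘ u).map Nat.fib).sum := by
      simp only [Multiset.map_cons, Multiset.sum_cons]; omega
    have hsq : ((n ::ₘ n ::ₘ u).map fun i => Nat.fib i ^ 2).sum <
        ((a ::ₘ b ::ₘ u).map fun i => Nat.fib i ^ 2).sum := by
      simp only [Multiset.map_cons, Multiset.sum_cons]
      obtain ⟨e, he⟩ := Nat.exists_eq_add_of_lt ha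
      have : Nat.fib n = Nat.fib b + e + 1 := by omega
      nlinarith
    have hle := sq_le (a ::ₘ b ::ₘ u)
    obtain ⟨T, hT, hT'⟩ := ih _ (by rw [hsum] at hle ⊢; omega) (a ::ₘ b ::ₘ u) rfl
    exact ⟨T, by simpa using hT, by rw [hT', hsum]⟩
  · refine ⟨s.toFinset, Multiset.toFinset_card_le s, ?_⟩
    rw [Finset.sum_multiset_map_count]
    refine Finset.sum_congr rfl fun i hi => ?_
    rw [Multiset.mem_toFinset] at hi
    -- Index `0` may still repeat, but contributes nothing.
    rcases Nat.eq_zero_or_pos i with rfl | hpos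
    · simp
    · have h1 : 1 ≤ s.count i := Multiset.one_le_count_iff_mem.2 hi
      have h2 : s.count i ≤ 1 := by
        by_contra! h2
        have := Multiset.le_count_iff_replicate_le.1 (show 2 ≤ s.count i by omega)
        obtain ⟨u, hu⟩ := Multiset.le_iff_exists_add.1 this
        refine hdup ⟨i, hpos, u, ?_⟩
        rw [hu]
        simp [Multiset.replicate_succ]
      simp [le_antisymm h2 h1]

/-! ### Signed Fibonacci sums and colourings -/

/-- `x` is a sum of at most `m` Fibonacci numbers with signs. -/
def IsSignedFibSum (m : ℕ) (x : ℤ) : Prop :=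
  ∃ P Q : Multiset ℕ, Multiset.card P + Multiset.card Q ≤ m ∧
    x = ((P.map Nat.fib).sum : ℕ) - ((Q.map Nat.fib).sum : ℕ)

theorem IsSignedFibSum.zero : IsSignedFibSum 0 0 := ⟨0, 0, by simp, by simp⟩

theorem IsSignedFibSum.fib (n : ℕ) : IsSignedFibSum 1 (Nat.fib n) := ⟨{n}, 0, by simp, by simp⟩

theorem IsSignedFibSum.neg {m : ℕ} {x : ℤ} (h : IsSignedFibSum m x) : IsSignedFibSum m (-x) := by
  obtain ⟨P, Q, h, rfl⟩ := h
  exact ⟨Q, P, by omega, by ring⟩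

theorem IsSignedFibSum.add {m n : ℕ} {x y : ℤ} (hx : IsSignedFibSum m x)
    (hy : IsSignedFibSum n y) : IsSignedFibSum (m + n) (x + y) := by
  obtain ⟨P, Q, h, rfl⟩ := hx
  obtain ⟨P', Q', h', rfl⟩ := hy
  refine ⟨P + P', Q + Q', by simp only [Multiset.card_add]; omega, ?_⟩
  simp only [Multiset.map_add, Multiset.sum_add]
  push_cast
  ring

theorem IsSignedFibSum.mono {m n : ℕ} {x : ℤ} (h : IsSignedFibSum m x) (hmn : m ≤ n) :
    IsSignedFibSum n x := by
  obtain ⟨P, Q, h, rfl⟩ := h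
  exact ⟨P, Q, h.trans hmn, rfl⟩

noncomputable instance FibTreeVertex.instFintype (N : ℕ) : Fintype (FibTreeVertex N) :=
  Fintype.ofFinite _

theorem FibTreeVertex.sum_add_three {M : Type*} [AddCommMonoid M] {N : ℕ}
    (g : FibTreeVertex (N + 3) → M) :
    ∑ v, g v = (g (.root _) + g (.child N)) + (∑ v, g (.left v) + ∑ v, g (.right v)) := by
  rw [← (FibTreeVertex.equivSum N).symm.sum_comp]
  simp [FibTreeVertex.equivSum]

theorem FibTreeVertex.sum_of_lt_three {M : Type*} [AddCommMonoid M] {N : ℕ} (hN : N < 3)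
    (g : FibTreeVertex N → M) : ∑ v, g v = g (.root N) := by
  apply Fintype.sum_eq_single
  intro v hv
  rcases v with _ | _ | _ | _
  · exact absurd rfl hv
  all_goals omega

/-- The sign needed to pass from the sign `ε'` of a subtree to the sign `ε`. -/
theorem exists_signedFibSum_of_signs {ε ε' : ℤ} (hε : ε = 1 ∨ ε = -1) (hε' : ε' = 1 ∨ ε' = -1)
    (n : ℕ) : ∃ x, IsSignedFibSum (if ε = ε' then 0 else 1) x ∧
      ε' * Nat.fib n = ε * Nat.fib n + 2 * x := by
  rcases hε with rfl | rfl <;> rcases hε' with rfl | rfl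
  · exact ⟨0, by simpa using IsSignedFibSum.zero, by ring⟩
  · exact ⟨_, by simpa using (IsSignedFibSum.fib n).neg, by ring⟩
  · exact ⟨_, by simpa using (IsSignedFibSum.fib n), by ring⟩
  · exact ⟨0, by simpa using IsSignedFibSum.zero, by ring⟩

/-- For a proper colouring of a Fibonacci tree with `1`, `-1` and the free colour `0`, the sum of
the colours is close to `± F_N` plus twice a short signed sum of Fibonacci numbers. -/
theorem exists_signedFibSum_of_coloring : ∀ (N : ℕ) (_ : 1 ≤ N) (f : FibTreeVertex N → ℤ)
    (_ : ∀ v, f v = 0 ∨ f v = 1 ∨ f v = -1)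
    (_ : ∀ u v, FibTreeParent u v → f u = f v → f u = 0)
    (ε : ℤ) (_ : ε = 1 ∨ ε = -1) (_ : f (.root N) = 0 ∨ f (.root N) = ε),
    ∃ x, IsSignedFibSum (2 * ∑ v, if f v = 0 then 1 else 0) x ∧
      |∑ v, f v - (ε * Nat.fib N + 2 * x)| ≤ ((∑ v, if f v = 0 then 1 else 0 : ℕ) : ℤ)
  | 0, h, _, _, _, _, _, _ => by omega
  | 1, _, f, _, _, ε, hε, hr => by
      simp only [FibTreeVertex.sum_of_lt_three (show 1 < 3 by omega)]
      refine ⟨0, IsSignedFibSum.zero.mono (by omega), ?_⟩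
      rcases hε with rfl | rfl <;> rcases hr with h | h <;> simp [h]
  | 2, _, f, _, _, ε, hε, hr => by
      simp only [FibTreeVertex.sum_of_lt_three (show 2 < 3 by omega)]
      refine ⟨0, IsSignedFibSum.zero.mono (by omega), ?_⟩
      rcases hε with rfl | rfl <;> rcases hr with h | h <;> simp [h]
  | N + 3, _, f, hf, hp, ε, hε, hr => by
      have hrc := hp _ _ (FibTreeParent.root_child N)
      -- A coloured child forces the opposite sign on both subtrees; a yellow child lets each take
      -- the sign of its own root.
      have key : ∀ z : ℤ, (z = 0 ∨ z = 1 ∨ z = -1) →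
          (f (.child N) = z → f (.child N) = 0) → ∃ ε', (ε' = 1 ∨ ε' = -1) ∧ (z = 0 ∨ z = ε') ∧
            (f (.child N) ≠ 0 → ε' = - f (.child N)) := by
        intro z hz hcz
        rcases hf (.child N) with hc | hc | hc
        · rcases hz with rfl | rfl | rfl
          · exact ⟨1, by simp [hc]⟩
          · exact ⟨1, by simp [hc]⟩
          · exact ⟨-1, by simp [hc]⟩
        · exact ⟨-1, by simp, by rw [hc] at hcz; omega, by simp [hc]⟩
        · exact ⟨1, by simp, by rw [hc] at hcz; omega, by simp [hc]⟩
      obtain ⟨a, ha, har, hac⟩ := key (f (.left (.root _))) (hf _)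
        (fun h => hp _ _ (FibTreeParent.child_left N) h)
      obtain ⟨b, hb, hbr, hbc⟩ := key (f (.right (.root _))) (hf _)
        (fun h => hp _ _ (FibTreeParent.child_right N) h)
      obtain ⟨x, hx, hx'⟩ := exists_signedFibSum_of_coloring (N + 2) (by omega)
        (fun v => f (.left v)) (fun v => hf _) (fun u v h => hp _ _ h.left) a ha har
      obtain ⟨y, hy, hy'⟩ := exists_signedFibSum_of_coloring (N + 1) (by omega)
        (fun v => f (.right v)) (fun v => hf _) (fun u v h => hp _ _ h.right) b hb hbr
      obtain ⟨p, hpS, hpe⟩ := exists_signedFibSum_of_signs hε ha (N + 2)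
      obtain ⟨q, hqS, hqe⟩ := exists_signedFibSum_of_signs hε hb (N + 1)
      have hfib : (Nat.fib (N + 3) : ℤ) = Nat.fib (N + 1) + Nat.fib (N + 2) := by
        exact_mod_cast Nat.fib_add_two (n := N + 1)
      simp only [FibTreeVertex.sum_add_three]
      refine ⟨(p + q) + (x + y), ((hpS.add hqS).add (hx.add hy)).mono ?_, ?_⟩
      -- If root and child are both coloured, `a` and `b` equal `ε`; otherwise one yellow vertex
      -- pays for both flips.
      · have : (if ε = a then 0 else 1) + (if ε = b then 0 else 1) ≤
            2 * ((if f (.root (N + 3)) = 0 then 1 else 0) +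
              (if f (.child N) = 0 then 1 else 0) : ℕ) := by
          rcases hf (.child N) with hc | hc | hc <;> split_ifs <;> omega
        omega
      · have h2 : |f (.root (N + 3)) + f (.child N)| ≤
            (((if f (.root (N + 3)) = 0 then 1 else 0) +
              (if f (.child N) = 0 then 1 else 0) : ℕ) : ℤ) := by
          rcases hf (.child N) with hc | hc | hc <;>
          rcases hf (.root (N + 3)) with hr | hr | hr <;> simp [hr, hc] at hrc ⊢
        rw [hfib, mul_add]
        push_cast at h2 hx' hy' ⊢
        rw [abs_le] at h2 hx' hy' ⊢
        constructor <;> linarith [h2.1, h2.2, hx'.1, hx'.2, hy'.1, hy'.2]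

/-! ### Golden ratio estimates -/

open Real in
theorem fib_le_goldenRatio_pow (n : ℕ) : (Nat.fib (n + 1) : ℝ) ≤ goldenRatio ^ n := by
  induction n using Nat.twoStepInduction with
  | zero => simp
  | one => simpa using one_lt_goldenRatio.le
  | more n h1 h2 =>
    have := goldenRatio_sq
    rw [Nat.fib_add_two, pow_add, this]
    push_cast
    rw [pow_succ] at h2
    nlinarith

open Real in
theorem abs_goldenConj : |goldenConj| = goldenRatio⁻¹ := by
  rw [inv_goldenRatio, abs_of_neg goldenConj_neg]

open Real in
theorem inv_goldenRatio_le : goldenRatio⁻¹ ≤ 5 / 8 := by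
  rw [inv_le_comm₀ goldenRatio_pos (by norm_num), goldenRatio]
  have : (2.2 : ℝ) ≤ √5 := Real.le_sqrt_of_sq_le (by norm_num)
  linarith

open Real in
/-- Powers of the conjugate with distinct exponents at least `t` have a sum of order `φ⁻ᵗ`. -/
theorem abs_sum_goldenConj_pow_le (t : ℕ) (S : Finset ℕ) (hS : ∀ i ∈ S, t ≤ i) :
    |∑ i ∈ S, goldenConj ^ i| ≤ 8 / 3 * goldenRatio⁻¹ ^ t := by
  have hq := inv_goldenRatio_le
  have hq0 : (0 : ℝ) < goldenRatio⁻¹ := inv_pos.2 goldenRatio_pos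
  calc |∑ i ∈ S, goldenConj ^ i| ≤ ∑ i ∈ S, goldenRatio⁻¹ ^ i := by
        refine (Finset.abs_sum_le_sum_abs _ _).trans_eq ?_
        simp only [abs_pow, abs_goldenConj]
    _ ≤ ∑ i ∈ Finset.Ico t (S.sup id + 1), goldenRatio⁻¹ ^ i := by
        refine Finset.sum_le_sum_of_subset_of_nonneg (fun i hi => ?_) fun i _ _ => by positivity
        rw [Finset.mem_Ico]
        exact ⟨hS i hi, Nat.lt_succ_of_le (Finset.le_sup (f := id) hi)⟩
    _ ≤ goldenRatio⁻¹ ^ t / (1 - goldenRatio⁻¹) :=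
        geom_sum_Ico_le_of_lt_one hq0.le (by linarith)
    -- `8 / 3 = 1 / (1 - 5 / 8)`.
    _ ≤ 8 / 3 * goldenRatio⁻¹ ^ t := by
        rw [div_le_iff₀ (by linarith)]
        nlinarith [pow_pos hq0 t]

/-! ### The lower bound via norms -/

/-- Two consecutive Fibonacci numbers are not both even, so the norm form of `ℤ[φ]` does not vanish
at any pair congruent to them modulo `2`. -/
theorem fib_norm_ne_zero (N : ℕ) (ε x y : ℤ) (hε : ε = 1 ∨ ε = -1) :
    (ε * Nat.fib (N + 1) + 2 * y) ^ 2 -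
      (ε * Nat.fib (N + 1) + 2 * y) * (ε * Nat.fib N + 2 * x) -
      (ε * Nat.fib N + 2 * x) ^ 2 ≠ 0 := by
  intro h
  have hco := Nat.fib_coprime_fib_succ N
  have h2 : ¬ (2 ∣ Nat.fib N ∧ 2 ∣ Nat.fib (N + 1)) := fun ⟨h1, h2⟩ => by
    have := Nat.dvd_gcd h1 h2
    rw [hco] at this
    omega
  have h' := congrArg (Int.cast : ℤ → ZMod 2) h
  have e2 : (2 : ZMod 2) = 0 := rfl
  have eε : (ε : ZMod 2) = 1 := by rcases hε with rfl | rfl <;> rfl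
  push_cast at h'
  rw [e2, eε] at h'
  simp only [zero_mul, add_zero, one_mul] at h'
  apply h2
  rw [← ZMod.natCast_eq_zero_iff, ← ZMod.natCast_eq_zero_iff]
  -- The form is anisotropic modulo `2`.
  have key : ∀ u w : ZMod 2, w ^ 2 - w * u - u ^ 2 = 0 → u = 0 ∧ w = 0 := by decide
  exact key _ _ h'

open Finset in
theorem sum_fib_le_of_lt (j : ℕ) (S : Finset ℕ) (hS : ∀ i ∈ S, i < j) :
    ∑ i ∈ S, Nat.fib i ≤ Nat.fib (j + 1) := by
  rw [Nat.fib_succ_eq_succ_sum]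
  exact (Finset.sum_le_sum_of_subset fun i hi => mem_range.2 (hS i hi)).trans (Nat.le_succ _)

/-- A set with at most `m` elements misses one of `m + 1` consecutive intervals of length `12`. -/
theorem exists_gap (S : Finset ℕ) (m K : ℕ) (hS : S.card ≤ m) :
    ∃ i ≤ m, ∀ s ∈ S, s < K + 12 * i ∨ K + 12 * i + 12 ≤ s := by
  by_contra! h
  have hsub : Finset.range (m + 1) ⊆ S.image fun s => (s - K) / 12 := by
    intro i hi
    obtain ⟨s, hs, h1, h2⟩ := h i (by simpa [Nat.lt_succ_iff] using hi)
    exact Finset.mem_image.2 ⟨s, hs, by omega⟩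
  have := (Finset.card_le_card hsub).trans Finset.card_image_le
  rw [Finset.card_range] at this
  omega

open Real in
/-- `± F_N` plus twice a short signed sum of Fibonacci numbers is not small. -/
theorem fib_le_abs_add_two_mul_signedFibSum (N K m : ℕ) (hK : K + 12 * (m + 1) ≤ N) (ε x : ℤ)
    (hε : ε = 1 ∨ ε = -1) (hx : IsSignedFibSum m x) :
    (Nat.fib K : ℤ) < |ε * Nat.fib N + 2 * x| := by
  by_contra! hsmall
  obtain ⟨P', Q', hcard, hxPQ⟩ := hx
  obtain ⟨P, hPc, hP⟩ := exists_finset_sum_fib_eq P'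
  obtain ⟨Q, hQc, hQ⟩ := exists_finset_sum_fib_eq Q'
  rw [← hP, ← hQ] at hxPQ
  obtain ⟨i, him, hgap⟩ := exists_gap (P ∪ Q) m K ((Finset.card_union_le _ _).trans (by omega))
  set j := K + 12 * i with hj
  have split : ∀ S : Finset ℕ, S ⊆ P ∪ Q → ∃ l ≤ Nat.fib (j + 1), ∃ H : Finset ℕ,
      (∀ s ∈ H, j + 12 ≤ s) ∧ ∑ s ∈ S, Nat.fib s = l + ∑ s ∈ H, Nat.fib s := by
    intro S hS
    refine ⟨_, sum_fib_le_of_lt j (S.filter (· < j)) fun s hs => (Finset.mem_filter.1 hs).2,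
      S.filter (¬ · < j), fun s hs => ?_, (Finset.sum_filter_add_sum_filter_not S _ _).symm⟩
    rw [Finset.mem_filter] at hs
    exact (hgap s (hS hs.1)).resolve_left hs.2
  obtain ⟨lP, hlP, HP, hHP, eP⟩ := split P Finset.subset_union_left
  obtain ⟨lQ, hlQ, HQ, hHQ, eQ⟩ := split Q Finset.subset_union_right
  set X : ℤ := ((∑ s ∈ HP, Nat.fib s : ℕ) : ℤ) - (∑ s ∈ HQ, Nat.fib s : ℕ) with hX
  -- Shifting every index by one makes `W - φU` a combination of powers `ψ ^ s` with `s ≥ j + 12`,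
  -- where `ψ` is the conjugate of `φ`.
  set Y : ℤ := ((∑ s ∈ HP, Nat.fib (s + 1) : ℕ) : ℤ) - (∑ s ∈ HQ, Nat.fib (s + 1) : ℕ) with hY
  set U : ℤ := ε * Nat.fib N + 2 * X with hU
  set W : ℤ := ε * Nat.fib (N + 1) + 2 * Y with hW
  -- One share is the assumed bound `F_K`, two come from the doubled low part.
  have hUle : |U| ≤ 3 * Nat.fib (j + 1) := by
    have hmono : (Nat.fib K : ℤ) ≤ Nat.fib (j + 1) := by
      exact_mod_cast Nat.fib_mono (by omega)
    have h1 : (lP : ℤ) ≤ Nat.fib (j + 1) := by exact_mod_cast hlP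
    have h2 : (lQ : ℤ) ≤ Nat.fib (j + 1) := by exact_mod_cast hlQ
    rw [hxPQ, eP, eQ, abs_le] at hsmall
    push_cast at hsmall hX
    rw [abs_le]
    constructor <;> linarith [hsmall.1, hsmall.2, Int.natCast_nonneg lP, Int.natCast_nonneg lQ]
  have hconj : (W : ℝ) - goldenRatio * U =
      ε * goldenConj ^ N + 2 * (∑ s ∈ HP, goldenConj ^ s - ∑ s ∈ HQ, goldenConj ^ s) := by
    simp only [← fib_succ_sub_goldenRatio_mul_fib, Finset.sum_sub_distrib, ← Finset.mul_sum]
    rw [hW, hU, hX, hY]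
    push_cast
    ring
  have hq0 : (0 : ℝ) < goldenRatio⁻¹ := inv_pos.2 goldenRatio_pos
  have hq := inv_goldenRatio_le
  set q : ℝ := goldenRatio⁻¹ with hqdef
  -- `1 + 2 * (8/3 + 8/3) < 12`.
  have hE : |(W : ℝ) - goldenRatio * U| ≤ 12 * q ^ (j + 12) := by
    have h1 := abs_sum_goldenConj_pow_le _ HP hHP
    have h2 := abs_sum_goldenConj_pow_le _ HQ hHQ
    have h3 : |(ε : ℝ) * goldenConj ^ N| ≤ q ^ (j + 12) := by
      have : |(ε : ℝ)| = 1 := by rcases hε with rfl | rfl <;> simp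
      rw [abs_mul, this, one_mul, abs_pow, abs_goldenConj]
      exact pow_le_pow_of_le_one hq0.le (by linarith) (by omega)
    rw [hconj]
    rw [abs_le] at h1 h2 h3 ⊢
    have := pow_pos hq0 (j + 12)
    constructor <;> linarith [h1.1, h1.2, h2.1, h2.2, h3.1, h3.2]
  have hUr : |(U : ℝ)| ≤ 3 * goldenRatio ^ j := by
    have : (|(U : ℝ)|) ≤ 3 * Nat.fib (j + 1) := by exact_mod_cast hUle
    linarith [fib_le_goldenRatio_pow j]
  have hne : W ^ 2 - W * U - U ^ 2 ≠ 0 := fib_norm_ne_zero N ε X Y hε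
  have hge : (1 : ℝ) ≤ |(W : ℝ) ^ 2 - W * U - U ^ 2| := by
    exact_mod_cast Int.one_le_abs hne
  have hfac : (W : ℝ) ^ 2 - W * U - U ^ 2 =
      (W - goldenRatio * U) * ((W - goldenRatio * U) + √5 * U) := by
    have h1 := goldenRatio_sub_goldenConj
    have h2 := goldenRatio_mul_goldenConj
    have h3 := goldenRatio_add_goldenConj
    rw [← h1]
    linear_combination (-(W : ℝ) * U) * h3 - (U : ℝ) ^ 2 * h2
  rw [hfac, abs_mul] at hge
  have h5 : √5 ≤ 3 := by rw [Real.sqrt_le_left (by norm_num)]; norm_num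
  have h5' : 0 ≤ √5 := Real.sqrt_nonneg 5
  have hbig : |((W : ℝ) - goldenRatio * U) + √5 * U| ≤ 12 * q ^ (j + 12) + 9 * goldenRatio ^ j := by
    refine (abs_add_le _ _).trans (add_le_add hE ?_)
    rw [abs_mul, abs_of_nonneg h5']
    nlinarith [abs_nonneg (U : ℝ)]
  have hprod := mul_le_mul hE hbig (abs_nonneg _) (by positivity)
  have hcancel : q ^ j * goldenRatio ^ j = 1 := by
    rw [← mul_pow, hqdef, inv_mul_cancel₀ goldenRatio_ne_zero, one_pow]
  have hq12 : q ^ 12 ≤ 1 / 250 := (pow_le_pow_left₀ hq0.le hq 12).trans (by norm_num)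
  have hq12' : q ^ (j + 12) ≤ 1 / 250 :=
    (pow_le_pow_of_le_one hq0.le (by linarith) (by omega)).trans hq12
  -- Gap length `12` suffices: the norm is at most `144 / 250² + 108 / 250 < 1`.
  have hexp : 12 * q ^ (j + 12) * (12 * q ^ (j + 12) + 9 * goldenRatio ^ j) =
      144 * q ^ (j + 12) * q ^ (j + 12) + 108 * q ^ 12 := by
    linear_combination (108 * q ^ 12) * hcancel
  rw [hexp] at hprod
  have hpos := pow_pos hq0 (j + 12)
  nlinarith

/-! ### The theorem on decompositions -/

theorem FibTreeParent.ne {N : ℕ} {u v : FibTreeVertex N} (h : FibTreeParent u v) : u ≠ v := by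
  induction h with
  | left _ ih => simpa using ih
  | right _ ih => simpa using ih
  | _ => simp

theorem mainTheorem3 (N : ℕ) (hN : 96 ≤ N) (k : ℤ) (hk₀ : 0 ≤ k)
    (hk : (k : ℝ) ≤ (Nat.fib ⌈(N : ℝ) / 2 - 1⌉₊ : ℝ) - (N : ℝ) / 24 + 2)
    (l : ℝ) (hl₁ : 1 ≤ l) (hl : l ≤ (N : ℝ) / 48 - 1) :
    ¬ ∃ R B Y : Finset (FibTreeVertex N),
      IsRedBlueYellowDecomposition (fibTree N) k l R B Y := by
  classical
  rintro ⟨R, B, Y, hRB, hRY, hBY, hcov, hY, hR, hB, hk'⟩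
  let f : FibTreeVertex N → ℤ := fun v => (if v ∈ R then 1 else 0) - (if v ∈ B then 1 else 0)
  have hdisj : ∀ v, v ∈ R → v ∉ B := fun _ h => Finset.disjoint_left.1 hRB h
  have hf : ∀ v, f v = 0 ∨ f v = 1 ∨ f v = -1 := by
    intro v
    simp only [f]
    split_ifs <;> simp
  have hf0 : ∀ v, f v = 0 → v ∈ Y := by
    intro v hv
    rcases hcov v with h | h | h
    · simp [f, h, hdisj v h] at hv
    · have h' : v ∉ R := fun h' => hdisj v h' h
      simp [f, h, h'] at hv
    · exact h
  have hf1 : ∀ v, f v = 1 → v ∈ R := by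
    intro v
    simp only [f]
    split_ifs <;> simp_all
  have hf2 : ∀ v, f v = -1 → v ∈ B := by
    intro v
    simp only [f]
    split_ifs <;> simp_all
  have hproper : ∀ u v, FibTreeParent u v → f u = f v → f u = 0 := by
    intro u v h huv
    have ha : (fibTree N).Adj u v := by
      rw [fibTree, SimpleGraph.fromRel_adj]
      exact ⟨h.ne, Or.inl h⟩
    rcases hf u with h0 | h0 | h0
    · exact h0
    · exact absurd ha (hR (hf1 u h0) (hf1 v (huv ▸ h0)) ha.ne)
    · exact absurd ha (hB (hf2 u h0) (hf2 v (huv ▸ h0)) ha.ne)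
  obtain ⟨ε, hε, hr⟩ : ∃ ε : ℤ, (ε = 1 ∨ ε = -1) ∧ (f (.root N) = 0 ∨ f (.root N) = ε) := by
    rcases hf (.root N) with h | h | h
    · exact ⟨1, by simp [h]⟩
    · exact ⟨1, by simp [h]⟩
    · exact ⟨-1, by simp [h]⟩
  obtain ⟨x, hx, hx'⟩ := exists_signedFibSum_of_coloring N (by omega) f hf hproper ε hε hr
  have hsum : ∑ v, f v = k := by
    simp only [f, Finset.sum_sub_distrib, Finset.sum_boole, Finset.filter_univ_mem]
    exact hk'
  set y := ∑ v, if f v = 0 then 1 else 0 with hy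
  have hyY : y ≤ Y.card := by
    rw [hy, Finset.sum_boole]
    exact Finset.card_le_card fun v hv => hf0 v (by simpa using hv)
  have hyr : (y : ℝ) ≤ (N : ℝ) / 48 - 1 := by
    have : (y : ℝ) ≤ Y.card := by exact_mod_cast hyY
    linarith
  have hyN : 48 * y + 48 ≤ N := by
    have : (48 : ℝ) * y + 48 ≤ N := by linarith
    exact_mod_cast this
  set K := ⌈(N : ℝ) / 2 - 1⌉₊ with hK
  have hKN : 2 * K ≤ N := by
    have hN' : (96 : ℝ) ≤ N := by exact_mod_cast hN
    have := Nat.ceil_lt_add_one (show (0 : ℝ) ≤ (N : ℝ) / 2 - 1 by linarith)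
    rw [← hK] at this
    have : (2 : ℝ) * K ≤ N := by linarith
    exact_mod_cast this
  -- `K ≤ N / 2` and `12 * (2 * y + 1) ≤ N / 2` leave room for the gaps.
  have hlow := fib_le_abs_add_two_mul_signedFibSum N K (2 * y) (by omega) ε x hε hx
  have hup : |ε * Nat.fib N + 2 * x| ≤ k + y := by
    rw [hsum] at hx'
    rw [abs_le] at hx' ⊢
    constructor <;> linarith [hx'.1, hx'.2]
  -- The slack is `N / 24 - 2 - (N / 48 - 1) = N / 48 - 1 ≥ 0`.
  have hky : k + y ≤ (Nat.fib K : ℤ) := by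
    have hN' : (96 : ℝ) ≤ N := by exact_mod_cast hN
    have : (k : ℝ) + y ≤ Nat.fib K := by linarith
    exact_mod_cast this
  omega
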